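/- Let $\mathfrak{sl}_n$ be the Lie algebra of traceless complex $n\times n$ matrices, with Cartan subalgebra $\mathfrak h$ spanned by $h_k=e_{k,k}-e_{k+1,k+1}$ ($1\le k\le n-1$), fundamental weights $\omega_k=\epsilon_1+\dots+\epsilon_k$ (where $\epsilon_k$ is the $k$-th diagonal entry) and simple roots $\alpha_k=\epsilon_k-\epsilon_{k+1}$. Write $\omega_{\mathbf w}=\sum_k w_k\omega_k$ and $\alpha_{\mathbf v}=\sum_k v_k\alpha_k$ for $\mathbf v,\mathbf w\in(\mathbb Z_{\ge 0})^{n-1}$, and let $L(\lambda)$ be the irreducible $\mathfrak{sl}_n$-module of highest weight $\lambda$. The weight $\omega_{\mathbf w}$ is called a partition of $d$ if $|\lambda(\mathbf w)|=d$, where $\lambda(\mathbf w)_k=w_k+\dots+w_{n-1}$; equivalently, if $\sum_k k w_k=d$. For $d\ge 0$ let $I_d\subset U(\mathfrak{sl}_n)$ be the annihilator of $(\mathbb C^n)^{\otimes d}$, where $\mathbb C^n$ is the natural module. For $\mathbf w\in(\mathbb Z_{\ge0})^{n-1}$ let $J_{\mathbf w}\subset U(\mathfrak{sl}_n)$ be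 the annihilator of $\bigoplus_{\mathbf v}L(\omega_{\mathbf w}-\alpha_{\mathbf v})$, the sum over all $\mathbf v$ such that $\omega_{\mathbf w}-\alpha_{\mathbf v}$ is dominant integral and is a weight of $L(\omega_{\mathbf w})$. Take $n=3$, $\mathbf w=(1,1)$ and $d=3$. Then: 1. $\omega_{\mathbf w}=\omega_1+\omega_2$, and it is a partition of $3$; 2. $3\omega_1$ is a partition of $3$, but it is not a weight of $L(\omega_1+\omega_2)$; 3. $I_3\neq J_{(1,1)}$, and the quotients $U(\mathfrak{sl}_3)/I_3$ and $U(\mathfrak{sl}_3)/J_{(1,1)}$ are different, even up to isomorphism: they are not isomorphic as $\mathbb C$-algebras. -/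

import Mathlib

open scoped TensorProduct DirectSum

noncomputable section

namespace SlQuotients

attribute [local instance 100] LieRing.ofAssociativeRing

/-- The Lie algebra `𝔰𝔩ₙ` over `ℂ` with `n = r + 1`, so that `r` is its rank and `Fin r` indexes
the nodes of the Dynkin diagram. -/
abbrev Sl (r : ℕ) : Type := LieAlgebra.SpecialLinear.sl (Fin (r + 1)) ℂ

/-- The universal enveloping algebra `U(𝔰𝔩ₙ)`, `n = r + 1`. -/
abbrev U (r : ℕ) : Type := UniversalEnvelopingAlgebra ℂ (Sl r)

/-- The canonical map `𝔰𝔩ₙ → U(𝔰𝔩ₙ)`. -/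
abbrev toU (r : ℕ) : Sl r →ₗ⁅ℂ⁆ U r := UniversalEnvelopingAlgebra.ι ℂ

/-! ### The Cartan subalgebra and weights -/

/-- The coroot `h_k = e_{k,k} - e_{k+1,k+1}`. -/
def coroot (r : ℕ) (k : Fin r) : Sl r :=
  LieAlgebra.SpecialLinear.singleSubSingle k.castSucc k.succ (1 : ℂ)

/-- The Cartan subalgebra `𝔥`, spanned by the `h_k`. -/
def cartan (r : ℕ) : Submodule ℂ (Sl r) := Submodule.span ℂ (Set.range (coroot r))

/-- `h_k` as an element of `𝔥`. -/
def corootH (r : ℕ) (k : Fin r) : cartan r :=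
  ⟨coroot r k, Submodule.subset_span (Set.mem_range_self k)⟩

/-- The dual space `𝔥^*`. -/
abbrev Wt (r : ℕ) : Type := Module.Dual ℂ (cartan r)

/-- `ε_k ∈ 𝔥^*`: the `k`-th diagonal entry. -/
def eps (r : ℕ) (k : Fin (r + 1)) : Wt r where
  toFun h := (h : Sl r).val k k
  map_add' _ _ := rfl
  map_smul' _ _ := rfl

/-- The simple root `α_k = ε_k - ε_{k+1}`. -/
def simpleRoot (r : ℕ) (k : Fin r) : Wt r := eps r k.castSucc - eps r k.succ

/-- The fundamental weight `ω_k = ε_1 + ⋯ + ε_k`. With the indices starting from `0`, the weight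
written `ω_{k+1}` on paper is `fundWeight r k`. -/
def fundWeight (r : ℕ) (k : Fin r) : Wt r := ∑ i ∈ Finset.Iic k.castSucc, eps r i

/-- `ω_w = ∑ w_k ω_k`. -/
def omega (r : ℕ) (w : Fin r → ℕ) : Wt r := ∑ k, w k • fundWeight r k

/-- `α_v = ∑ v_k α_k`. -/
def alpha (r : ℕ) (v : Fin r → ℕ) : Wt r := ∑ k, v k • simpleRoot r k

/-- A weight is dominant integral if its values on all the coroots are nonnegative integers. -/
def IsDominantIntegral {r : ℕ} (μ : Wt r) : Prop := ∀ k : Fin r, ∃ m : ℕ, μ (corootH r k) = m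

/-- The parts `λ_k = w_k + ⋯ + w_{n-1}` of the partition `λ(w)` attached to `ω_w`. -/
def part {r : ℕ} (w : Fin r → ℕ) (k : Fin r) : ℕ := ∑ i ∈ Finset.Ici k, w i

/-- The dominant integral weight `μ = ω_w` is a partition of `d`: `|λ(w)| = d`. -/
def IsPartitionOf {r : ℕ} (μ : Wt r) (d : ℕ) : Prop :=
  ∃ w : Fin r → ℕ, μ = omega r w ∧ ∑ k, part w k = d

/-- `μ` is a weight of the `U(𝔰𝔩ₙ)`-module `M`: its weight space is nonzero. -/
def IsWeight {r : ℕ} (M : Type*) [AddCommGroup M] [Module (U r) M] (μ : Wt r) : Prop :=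
  ∃ m : M, m ≠ 0 ∧ ∀ h : cartan r, toU r h • m = algebraMap ℂ (U r) (μ h) • m

/-! ### The irreducible highest weight modules -/

/-- The left ideal of `U(𝔰𝔩ₙ)` generated by the strictly upper triangular matrices and the
elements `h - μ(h)`, `h ∈ 𝔥`. -/
def vermaIdeal (r : ℕ) (μ : Wt r) : Ideal (U r) :=
  Ideal.span
    ({u | ∃ x : Sl r, (∀ i j, j ≤ i → x.val i j = 0) ∧ u = toU r x} ∪
      {u | ∃ h : cartan r, u = toU r h - algebraMap ℂ (U r) (μ h)})

/-- The Verma module of highest weight `μ`. -/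
abbrev Verma (r : ℕ) (μ : Wt r) : Type := U r ⧸ vermaIdeal r μ

/-- The sum of all the proper submodules of the Verma module, which is its largest proper
submodule. -/
def vermaRadical (r : ℕ) (μ : Wt r) : Submodule (U r) (Verma r μ) :=
  sSup {N | N ≠ ⊤}

/-- `L(μ)`, the irreducible module of highest weight `μ`: the unique irreducible quotient of the
Verma module. -/
abbrev IrrL (r : ℕ) (μ : Wt r) : Type := Verma r μ ⧸ vermaRadical r μ

/-! ### The ideal `J_w` -/

/-- The vectors `v` such that `ω_w - α_v` is dominant integral and is a weight of `L(ω_w)`. -/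
abbrev NakIndex (r : ℕ) (w : Fin r → ℕ) : Type :=
  {v : Fin r → ℕ // IsDominantIntegral (omega r w - alpha r v) ∧
    IsWeight (IrrL r (omega r w)) (omega r w - alpha r v)}

/-- `J_w`: the annihilator in `U(𝔰𝔩ₙ)` of `⨁_v L(ω_w - α_v)`. -/
def nakajimaIdeal (r : ℕ) (w : Fin r → ℕ) : Ideal (U r) :=
  Module.annihilator (U r) (⨁ v : NakIndex r w, IrrL r (omega r w - alpha r v.1))

instance (r : ℕ) (w : Fin r → ℕ) : (nakajimaIdeal r w).IsTwoSided :=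
  inferInstanceAs (Module.annihilator _ _).IsTwoSided

/-! ### The ideal `I_d` -/

/-- The tensor power `(ℂⁿ)^{⊗ d}`, `n = r + 1`. -/
abbrev TensorV (r d : ℕ) : Type := ⨂[ℂ]^d (Fin (r + 1) → ℂ)

/-- The operator `1 ⊗ ⋯ ⊗ a ⊗ ⋯ ⊗ 1` on the tensor power, with `a` in the `i`-th place. -/
def placeAt (r d : ℕ) (i : Fin d) :
    Module.End ℂ (Fin (r + 1) → ℂ) →ₗ[ℂ] Module.End ℂ (TensorV r d) :=
  (PiTensorProduct.mapMultilinear ℂ (fun _ : Fin d => Fin (r + 1) → ℂ)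
    (fun _ : Fin d => Fin (r + 1) → ℂ)).toLinearMap (fun _ => LinearMap.id) i

theorem placeAt_apply (r d : ℕ) (i : Fin d) (a : Module.End ℂ (Fin (r + 1) → ℂ)) :
    placeAt r d i a = PiTensorProduct.map (Function.update (fun _ => 1) i a) := rfl

theorem placeAt_mul_same (r d : ℕ) (i : Fin d) (a b : Module.End ℂ (Fin (r + 1) → ℂ)) :
    placeAt r d i a * placeAt r d i b = placeAt r d i (a * b) := by
  simp only [placeAt_apply, ← PiTensorProduct.map_mul]
  congr 1
  funext j
  by_cases h : j = i
  · subst h; simp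
  · simp [h]

theorem placeAt_mul_comm (r d : ℕ) {i j : Fin d} (hij : i ≠ j)
    (a b : Module.End ℂ (Fin (r + 1) → ℂ)) :
    placeAt r d i a * placeAt r d j b = placeAt r d j b * placeAt r d i a := by
  simp only [placeAt_apply, ← PiTensorProduct.map_mul]
  congr 1
  funext k
  by_cases h : k = i
  · subst h; simp [hij]
  · simp [h]

theorem sum_commutator {A : Type*} [Ring A] {d : ℕ} (p q : Fin d → A)
    (h : ∀ i j, i ≠ j → p i * q j = q j * p i) :
    ∑ i, (p i * q i - q i * p i) = (∑ i, p i) * (∑ i, q i) - (∑ i, q i) * (∑ i, p i) := by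
  rw [Finset.sum_mul_sum, Finset.sum_mul_sum, Finset.sum_comm (f := fun i j => q i * p j),
    ← Finset.sum_sub_distrib]
  refine Finset.sum_congr rfl fun i _ => ?_
  rw [← Finset.sum_sub_distrib]
  symm
  apply Finset.sum_eq_single i
  · intro j _ hj
    rw [h i j hj.symm, sub_self]
  · simp

/-- The action of `𝔰𝔩ₙ` on `(ℂⁿ)^{⊗ d}`, where `ℂⁿ` is the natural module:
`x` acts by `∑ᵢ 1 ⊗ ⋯ ⊗ x ⊗ ⋯ ⊗ 1`. -/
def tensorRep (r d : ℕ) : Sl r →ₗ⁅ℂ⁆ Module.End ℂ (TensorV r d) where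
  toFun x := ∑ i, placeAt r d i (Matrix.toLin' x.val)
  map_add' x y := by simp [Finset.sum_add_distrib]
  map_smul' c x := by simp [Finset.smul_sum]
  map_lie' := by
    intro x y
    have h : Matrix.toLin' (⁅x, y⁆ : Sl r).val =
        Matrix.toLin' x.val * Matrix.toLin' y.val
          - Matrix.toLin' y.val * Matrix.toLin' x.val := by
      rw [LieAlgebra.SpecialLinear.sl_bracket, map_sub, Matrix.toLin'_mul, Matrix.toLin'_mul]
      rfl
    simp only [h, map_sub, ← placeAt_mul_same]
    exact sum_commutator (fun i => placeAt r d i (Matrix.toLin' x.val))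
      (fun i => placeAt r d i (Matrix.toLin' y.val)) fun i j hij => placeAt_mul_comm r d hij _ _

/-- `I_d`: the annihilator of `(ℂⁿ)^{⊗ d}` in `U(𝔰𝔩ₙ)`, that is, the kernel of the algebra
homomorphism `U(𝔰𝔩ₙ) → End((ℂⁿ)^{⊗ d})` which extends the action of `𝔰𝔩ₙ`. -/
def ginzburgIdeal (r d : ℕ) : Ideal (U r) :=
  RingHom.ker (UniversalEnvelopingAlgebra.lift ℂ (tensorRep r d))

instance (r d : ℕ) : (ginzburgIdeal r d).IsTwoSided :=
  inferInstanceAs (RingHom.ker _).IsTwoSided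

end SlQuotients

end

open SlQuotients

namespace SlQuotients

attribute [local instance 100] LieRing.ofAssociativeRing

/-! The two quotients are told apart by the degrees of polynomials that elements satisfy, an
invariant of `ℂ`-algebras. The dominant weights of the form `ω₁ + ω₂ - α_v` are only the highest
root and `0`. Both have highest weight vectors among the 3 × 3 matrices under commutators, so
whatever kills this 9-dimensional module lies in `J` (`mem_nakajimaIdeal_of_matrixAct_eq_zero`). By
Cayley–Hamilton every element of `U/J` is then a root of a monic polynomial of degree 9.

In `U/I₃` this fails: the symmetric cube of `ℂ³` has ten weights, and a diagonal matrix separating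
them has ten eigenvalues on the tensor cube (`aeval_separatingElement_notMem`). Distinctness of the
ideals follows from the absence of an isomorphism. Neither complete reducibility nor a description
of `L(μ)` is needed: `L(μ)` is compared with a concrete module through the Verma module. -/

/-! ### Annihilators of irreducible highest weight modules -/

/-- An element of `U(𝔰𝔩ₙ)` which acts by zero on a module containing a nonzero highest weight
vector of weight `μ` acts by zero on `L(μ)`. -/
theorem mem_annihilator_irrL {r : ℕ} {μ : Wt r} {V : Type*} [AddCommGroup V] [Module ℂ V]
    (ρ : U r →ₐ[ℂ] Module.End ℂ V) {v : V} (hv : v ≠ 0)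
    (hup : ∀ x : Sl r, (∀ i j, j ≤ i → x.val i j = 0) → ρ (toU r x) v = 0)
    (hwt : ∀ h : cartan r, ρ (toU r h) v = μ h • v) {a : U r} (ha : ρ a = 0) :
    a ∈ Module.annihilator (U r) (IrrL r μ) := by
  -- `I` is the left ideal annihilating `v`. It contains `vermaIdeal r μ` but not `1`, so its image
  -- in the Verma module is a proper submodule and lies in the radical.
  let I : Ideal (U r) :=
    { carrier := {u | ρ u v = 0}
      add_mem' := fun {x y} hx hy => by
        simp only [Set.mem_ofPred_eq] at hx hy ⊢
        rw [map_add, LinearMap.add_apply, hx, hy, add_zero]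
      zero_mem' := by simp
      smul_mem' := fun c x hx => by
        simp only [Set.mem_ofPred_eq] at hx ⊢
        rw [smul_eq_mul, map_mul, Module.End.mul_apply, hx, map_zero] }
  have hI : ∀ u, u ∈ I ↔ ρ u v = 0 := fun u => Iff.rfl
  have hle : vermaIdeal r μ ≤ I := by
    refine Ideal.span_le.2 ?_
    rintro u (⟨x, hx, rfl⟩ | ⟨h, rfl⟩)
    · exact hup x hx
    · change ρ _ v = 0
      rw [map_sub, LinearMap.sub_apply, hwt, AlgHom.commutes, Module.algebraMap_end_apply, sub_self]
  let N : Submodule (U r) (Verma r μ) := Submodule.map (Submodule.mkQ (vermaIdeal r μ)) I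
  have hN : N ≠ ⊤ := by
    intro h
    have h1 : Submodule.mkQ (vermaIdeal r μ) 1 ∈ N := h ▸ Submodule.mem_top
    obtain ⟨u, hu, hu1⟩ := h1
    have h2 : u - 1 ∈ I := by
      apply hle
      rw [← Submodule.ker_mkQ (vermaIdeal r μ), LinearMap.mem_ker, map_sub, hu1, sub_self]
    have h3 : (1 : U r) ∈ I := by simpa using I.sub_mem hu h2
    rw [hI, map_one] at h3
    exact hv h3
  have hNle : N ≤ vermaRadical r μ := le_sSup hN
  rw [Module.mem_annihilator]
  intro m
  obtain ⟨y, rfl⟩ := Submodule.mkQ_surjective _ m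
  obtain ⟨u, rfl⟩ := Submodule.mkQ_surjective _ y
  rw [← map_smul, ← map_smul, ← LinearMap.mem_ker, Submodule.ker_mkQ]
  -- The product `a * u` kills `v` because `ρ a = 0`, so its class already vanishes in `L(μ)`.
  refine hNle ⟨a • u, ?_, rfl⟩
  change ρ _ v = 0
  rw [smul_eq_mul, map_mul, ha, zero_mul, LinearMap.zero_apply]

/-! ### The commutator action on matrices -/

/-- The action of `𝔰𝔩ₙ` on all `n × n` matrices by commutators. -/
def matrixRep (r : ℕ) :
    Sl r →ₗ⁅ℂ⁆ Module.End ℂ (Matrix (Fin (r + 1)) (Fin (r + 1)) ℂ) :=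
  (LieAlgebra.ad ℂ (Matrix (Fin (r + 1)) (Fin (r + 1)) ℂ)).comp
    (LieAlgebra.SpecialLinear.sl (Fin (r + 1)) ℂ).incl

theorem matrixRep_apply (r : ℕ) (x : Sl r) (m : Matrix (Fin (r + 1)) (Fin (r + 1)) ℂ) :
    matrixRep r x m = x.val * m - m * x.val := rfl

/-- The extension of `matrixRep` to the enveloping algebra. -/
def matrixAct (r : ℕ) : U r →ₐ[ℂ] Module.End ℂ (Matrix (Fin (r + 1)) (Fin (r + 1)) ℂ) :=
  UniversalEnvelopingAlgebra.lift ℂ (matrixRep r)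

theorem matrixAct_toU (r : ℕ) (x : Sl r) (m : Matrix (Fin (r + 1)) (Fin (r + 1)) ℂ) :
    matrixAct r (toU r x) m = x.val * m - m * x.val := by
  rw [matrixAct, UniversalEnvelopingAlgebra.lift_ι_apply, matrixRep_apply]

/-! ### Weights of the Cartan subalgebra -/

theorem coroot_val (r : ℕ) (k : Fin r) :
    (coroot r k).val = Matrix.single k.castSucc k.castSucc 1 - Matrix.single k.succ k.succ 1 := rfl

theorem cartan_offDiag {r : ℕ} (h : cartan r) {i j : Fin (r + 1)} (hij : i ≠ j) :
    (h : Sl r).val i j = 0 := by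
  obtain ⟨x, hx⟩ := h
  change x.val i j = 0
  induction hx using Submodule.span_induction with
  | mem x hx =>
    obtain ⟨k, rfl⟩ := hx
    rw [coroot_val, Matrix.sub_apply, Matrix.single_apply_of_ne, Matrix.single_apply_of_ne, sub_zero]
    · rintro ⟨rfl, rfl⟩; exact hij rfl
    · rintro ⟨rfl, rfl⟩; exact hij rfl
  | zero => rfl
  | add x y _ _ hx hy =>
    change x.val i j + y.val i j = 0
    rw [hx, hy, add_zero]
  | smul c x _ hx =>
    change c • x.val i j = 0
    rw [hx, smul_zero]

theorem cartan_eq_diagonal {r : ℕ} (h : cartan r) :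
    (h : Sl r).val = Matrix.diagonal (fun i => eps r i h) := by
  ext i j
  by_cases hij : i = j
  · subst hij; rw [Matrix.diagonal_apply_eq]; rfl
  · rw [cartan_offDiag h hij, Matrix.diagonal_apply_ne _ hij]

theorem sum_eps (r : ℕ) : ∑ i, eps r i = 0 := by
  ext h
  rw [LinearMap.sum_apply]
  exact LinearMap.mem_ker.1 (h : Sl r).2

theorem eps_corootH (r : ℕ) (i : Fin (r + 1)) (k : Fin r) :
    eps r i (corootH r k) = (if i = k.castSucc then 1 else 0) - (if i = k.succ then 1 else 0) := by
  change (coroot r k).val i i = _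
  simp [coroot_val, Matrix.single_apply, eq_comm]

theorem fundWeight_zero : fundWeight 2 0 = eps 2 0 := by
  have : Finset.Iic (0 : Fin 2).castSucc = {(0 : Fin 3)} := by decide
  rw [fundWeight, this]; simp

theorem fundWeight_one : fundWeight 2 1 = eps 2 0 + eps 2 1 := by
  have : Finset.Iic (1 : Fin 2).castSucc = {(0 : Fin 3), 1} := by decide
  rw [fundWeight, this]; simp

theorem fundWeight_add : fundWeight 2 0 + fundWeight 2 1 = eps 2 0 - eps 2 2 := by
  have h := sum_eps 2
  rw [Fin.sum_univ_three] at h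
  rw [fundWeight_zero, fundWeight_one, ← sub_eq_zero, ← h]
  abel

theorem omega_one_one : omega 2 ![1, 1] = fundWeight 2 0 + fundWeight 2 1 := by
  simp [omega]

theorem omega_three_zero : omega 2 ![3, 0] = 3 • fundWeight 2 0 := by
  simp [omega]

theorem sum_part (a b : ℕ) : ∑ k, part (r := 2) ![a, b] k = a + 2 * b := by
  have h0 : Finset.Ici (0 : Fin 2) = {0, 1} := by decide
  have h1 : Finset.Ici (1 : Fin 2) = {1} := by decide
  simp [part, h0, h1]
  ring

/-- The dominant integral weights of the form `ω₁ + ω₂ - α_v` are `ω₁ + ω₂` and `0`. -/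
theorem eq_of_isDominantIntegral_sub_alpha {v : Fin 2 → ℕ}
    (h : IsDominantIntegral (omega 2 ![1, 1] - alpha 2 v)) : v = 0 ∨ v = 1 := by
  have hα : alpha 2 v = v 0 • (eps 2 0 - eps 2 1) + v 1 • (eps 2 1 - eps 2 2) := by
    simp [alpha, simpleRoot]
  obtain ⟨a, ha⟩ := h 0
  obtain ⟨b, hb⟩ := h 1
  rw [omega_one_one, fundWeight_add, hα] at ha hb
  simp [eps_corootH] at ha hb
  -- Dominance is an equation in `ℂ`; it is moved to `ℤ` so that `omega` can solve `2v₀ - v₁ ≤ 1`,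
  -- `2v₁ - v₀ ≤ 1`.
  have ha' : (1 : ℤ) - (v 0 * (1 + 1) - v 1) = a := by
    have : ((1 - (v 0 * (1 + 1) - v 1) : ℤ) : ℂ) = (a : ℤ) := by
      push_cast; linear_combination ha
    exact_mod_cast this
  have hb' : (1 : ℤ) - (v 1 * (1 + 1) - v 0) = b := by
    have : ((1 - (v 1 * (1 + 1) - v 0) : ℤ) : ℂ) = (b : ℤ) := by
      push_cast; linear_combination hb
    exact_mod_cast this
  have : (v 0 = 0 ∧ v 1 = 0) ∨ (v 0 = 1 ∧ v 1 = 1) := by omega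
  rcases this with ⟨h0, h1⟩ | ⟨h0, h1⟩
  · left; ext k; fin_cases k <;> simp [h0, h1]
  · right; ext k; fin_cases k <;> simp [h0, h1]

/-! ### Degree bound in `U/J` -/

/-- The matrix unit in the upper right corner is a highest weight vector of weight `ε₁ - ε₃`. -/
theorem mem_annihilator_irrL_highestRoot {a : U 2} (ha : matrixAct 2 a = 0) :
    a ∈ Module.annihilator (U 2) (IrrL 2 (eps 2 0 - eps 2 2)) := by
  refine mem_annihilator_irrL (matrixAct 2) (v := Matrix.single 0 2 1) ?_ ?_ ?_ ha
  · intro h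
    simpa using congrFun (congrFun h 0) 2
  · intro x hx
    rw [matrixAct_toU]
    ext i j
    have h1 : ∀ i, x.val i 0 = 0 := fun i => hx i 0 (Fin.zero_le i)
    have h2 : ∀ j, x.val 2 j = 0 := fun j => hx 2 j (Fin.le_last j)
    simp [Matrix.mul_apply, Fin.sum_univ_three, Matrix.single_apply, h1, h2]
  · intro h
    rw [matrixAct_toU, cartan_eq_diagonal]
    ext i j
    rw [Matrix.sub_apply, Matrix.diagonal_mul, Matrix.mul_diagonal, Matrix.smul_apply,
      Matrix.single_apply]
    split_ifs with hij
    · obtain ⟨rfl, rfl⟩ := hij; simp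
    · simp

/-- The identity matrix commutes with everything, so it is a highest weight vector of weight `0`. -/
theorem mem_annihilator_irrL_zero {r : ℕ} {a : U r} (ha : matrixAct r a = 0) :
    a ∈ Module.annihilator (U r) (IrrL r 0) := by
  refine mem_annihilator_irrL (matrixAct r) (v := 1) one_ne_zero ?_ ?_ ha
  · intro x _
    rw [matrixAct_toU, mul_one, one_mul, sub_self]
  · intro h
    rw [matrixAct_toU, mul_one, one_mul, sub_self, LinearMap.zero_apply, zero_smul]

theorem mem_nakajimaIdeal_of_matrixAct_eq_zero {a : U 2} (ha : matrixAct 2 a = 0) :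
    a ∈ nakajimaIdeal 2 ![1, 1] := by
  rw [nakajimaIdeal, Module.mem_annihilator]
  intro m
  ext1 v
  rw [DirectSum.smul_apply, DirectSum.zero_apply]
  suffices h : a ∈ Module.annihilator (U 2) (IrrL 2 (omega 2 ![1, 1] - alpha 2 v.1)) from
    Module.mem_annihilator.1 h _
  rcases eq_of_isDominantIntegral_sub_alpha v.2.1 with h | h
  · have : omega 2 ![1, 1] - alpha 2 v.1 = eps 2 0 - eps 2 2 := by
      rw [h, omega_one_one, fundWeight_add]; simp [alpha]
    rw [this]
    exact mem_annihilator_irrL_highestRoot ha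
  · have : omega 2 ![1, 1] - alpha 2 v.1 = 0 := by
      rw [h, omega_one_one, fundWeight_add]; simp [alpha, simpleRoot]; abel
    rw [this]
    exact mem_annihilator_irrL_zero ha

open Polynomial in
/-- Every element of `U(𝔰𝔩₃)/J` is a root of a monic polynomial of degree nine. -/
theorem exists_monic_aeval_eq_zero (y : U 2 ⧸ nakajimaIdeal 2 ![1, 1]) :
    ∃ p : ℂ[X], p.Monic ∧ p.natDegree = 9 ∧ aeval y p = 0 := by
  obtain ⟨u, rfl⟩ := Ideal.Quotient.mkₐ_surjective ℂ (nakajimaIdeal 2 ![1, 1]) y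
  refine ⟨(matrixAct 2 u).charpoly, LinearMap.charpoly_monic _, ?_, ?_⟩
  · rw [LinearMap.charpoly_natDegree, Module.finrank_matrix]
    simp
  · rw [aeval_algHom_apply]
    refine Ideal.Quotient.eq_zero_iff_mem.2 (mem_nakajimaIdeal_of_matrixAct_eq_zero ?_)
    rw [← aeval_algHom_apply, LinearMap.aeval_self_charpoly]

/-! ### Ten eigenvalues on the tensor cube -/

/-- `diag(-5, -2, 7)`, whose ten weights on the symmetric cube of `ℂ³` are distinct. -/
def separatingElement : Sl 2 :=
  ⟨Matrix.diagonal ![-5, -2, 7],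
    LinearMap.mem_ker.2 (by
      change Matrix.trace (Matrix.diagonal (![-5, -2, 7] : Fin 3 → ℂ)) = 0
      rw [Matrix.trace_diagonal, Fin.sum_univ_three]
      change (-5 + -2 + 7 : ℂ) = 0
      norm_num)⟩

/-- The tensor product of standard basis vectors. -/
def basisTensor {r d : ℕ} (f : Fin d → Fin (r + 1)) : TensorV r d :=
  PiTensorProduct.tprod ℂ fun i => Pi.single (f i) 1

theorem basisTensor_ne_zero {r d : ℕ} (f : Fin d → Fin (r + 1)) : basisTensor f ≠ 0 := by
  intro h
  -- The product of the coordinates `f i` is a multilinear form with value `1` on this tensor.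
  let φ : MultilinearMap ℂ (fun _ : Fin d => Fin (r + 1) → ℂ) ℂ :=
    (MultilinearMap.mkPiAlgebra ℂ (Fin d) ℂ).compLinearMap fun i => LinearMap.proj (f i)
  have := congrArg (PiTensorProduct.lift φ) h
  rw [basisTensor, PiTensorProduct.lift.tprod, map_zero] at this
  simp [φ] at this

theorem tensorRep_diagonal {r d : ℕ} (x : Sl r) {c : Fin (r + 1) → ℂ}
    (hx : x.val = Matrix.diagonal c) (f : Fin d → Fin (r + 1)) :
    tensorRep r d x (basisTensor f) = (∑ i, c (f i)) • basisTensor f := by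
  change (∑ i, placeAt r d i (Matrix.toLin' x.val)) _ = _
  rw [LinearMap.sum_apply, Finset.sum_smul]
  refine Finset.sum_congr rfl fun i _ => ?_
  rw [placeAt_apply, basisTensor, PiTensorProduct.map_tprod]
  have : (fun j => (Function.update (fun _ => 1) i (Matrix.toLin' x.val) :
        Fin d → Module.End ℂ (Fin (r + 1) → ℂ)) j (Pi.single (f j) 1)) =
      Function.update (fun j => (Pi.single (f j) 1 : Fin (r + 1) → ℂ)) i
        (c (f i) • (Pi.single (f i) 1 : Fin (r + 1) → ℂ)) := by
    funext j
    by_cases hj : j = i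
    · subst hj
      rw [Function.update_self, Function.update_self, hx, Matrix.toLin'_apply]
      ext k
      rw [Matrix.mulVec_diagonal, Pi.smul_apply]
      by_cases hk : k = f j
      · subst hk; simp
      · simp [hk]
    · simp [hj]
  rw [this, MultilinearMap.map_update_smul, Function.update_eq_self]

-- Pure tensors of basis vectors are eigenvectors of a diagonal matrix, so a polynomial in it that
-- acts by zero vanishes at each eigenvalue.
open Polynomial in
theorem eval_eq_zero_of_mem_ginzburgIdeal {r d : ℕ} (x : Sl r) {c : Fin (r + 1) → ℂ}
    (hx : x.val = Matrix.diagonal c) {p : ℂ[X]} (hp : aeval (toU r x) p ∈ ginzburgIdeal r d)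
    (f : Fin d → Fin (r + 1)) : p.eval (∑ i, c (f i)) = 0 := by
  rw [ginzburgIdeal, RingHom.mem_ker, ← aeval_algHom_apply,
    UniversalEnvelopingAlgebra.lift_ι_apply] at hp
  have h := Module.End.aeval_apply_of_hasEigenvector (p := p)
    (Module.End.hasEigenvector_iff.2
      ⟨Module.End.mem_eigenspace_iff.2 (tensorRep_diagonal x hx f), basisTensor_ne_zero f⟩)
  rw [hp, LinearMap.zero_apply, eq_comm, smul_eq_zero] at h
  exact h.resolve_right (basisTensor_ne_zero f)

open Polynomial in
theorem aeval_separatingElement_notMem {p : ℂ[X]} (hp : p.Monic) (hdeg : p.natDegree = 9) :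
    aeval (toU 2 separatingElement) p ∉ ginzburgIdeal 2 3 := by
  intro hmem
  have key : ∀ a b c : Fin 3, p.eval ((![-5, -2, 7] : Fin 3 → ℂ) a +
      (![-5, -2, 7] : Fin 3 → ℂ) b + (![-5, -2, 7] : Fin 3 → ℂ) c) = 0 := by
    intro a b c
    have := eval_eq_zero_of_mem_ginzburgIdeal separatingElement rfl hmem ![a, b, c]
    rw [Fin.sum_univ_three] at this
    exact this
  have h7 : (![-5, -2, 7] : Fin 3 → ℂ) 2 = 7 := rfl
  -- All sums of three entries of `-5, -2, 7`, repetition allowed: ten distinct numbers, more roots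
  -- than degree 9 permits.
  let s : Finset ℤ := {-15, -12, -9, -6, -3, 0, 3, 9, 12, 21}
  let t : Finset ℂ := s.map ⟨fun z : ℤ => (z : ℂ), Int.cast_injective⟩
  have hcard : t.card = 10 := by rw [Finset.card_map]; decide
  refine hp.ne_zero (eq_zero_of_natDegree_lt_card_of_eval_eq_zero' p t ?_ (by omega))
  intro z hz
  obtain ⟨k, hk, rfl⟩ := Finset.mem_map.1 hz
  simp only [s, Finset.mem_insert, Finset.mem_singleton] at hk
  change p.eval (k : ℂ) = 0
  rcases hk with rfl | rfl | rfl | rfl | rfl | rfl | rfl | rfl | rfl | rfl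
  · convert key 0 0 0 using 2; norm_num [h7]
  · convert key 0 0 1 using 2; norm_num [h7]
  · convert key 0 1 1 using 2; norm_num [h7]
  · convert key 1 1 1 using 2; norm_num [h7]
  · convert key 0 0 2 using 2; norm_num [h7]
  · convert key 0 1 2 using 2; norm_num [h7]
  · convert key 1 1 2 using 2; norm_num [h7]
  · convert key 0 2 2 using 2; norm_num [h7]
  · convert key 1 2 2 using 2; norm_num [h7]
  · convert key 2 2 2 using 2; norm_num [h7]

theorem isEmpty_quotient_algEquiv :
    IsEmpty ((U 2 ⧸ ginzburgIdeal 2 3) ≃ₐ[ℂ] (U 2 ⧸ nakajimaIdeal 2 ![1, 1])) := by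
  refine ⟨fun e => ?_⟩
  let x := Ideal.Quotient.mkₐ ℂ (ginzburgIdeal 2 3) (toU 2 separatingElement)
  obtain ⟨p, hp, hdeg, h⟩ := exists_monic_aeval_eq_zero (e x)
  rw [Polynomial.aeval_algHom_apply, map_eq_zero_iff e e.injective,
    Polynomial.aeval_algHom_apply] at h
  exact aeval_separatingElement_notMem hp hdeg (Ideal.Quotient.eq_zero_iff_mem.1 h)

/-! ### The weight `3ω₁` -/

open Polynomial in
/-- If `p(h)` acts by zero on `M`, then the weights of `M` take values in the roots of `p`. -/
theorem IsWeight.eval_eq_zero {r : ℕ} {M : Type*} [AddCommGroup M] [Module (U r) M] {μ : Wt r}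
    (hμ : IsWeight M μ) (h : cartan r) {p : ℂ[X]}
    (hp : aeval (toU r h) p ∈ Module.annihilator (U r) M) : p.eval (μ h) = 0 := by
  obtain ⟨m, hm, hwt⟩ := hμ
  have h1 : ∀ q : ℂ[X], aeval (toU r h) q • m = algebraMap ℂ (U r) (q.eval (μ h)) • m := by
    intro q
    induction q using Polynomial.induction_on' with
    | add q₁ q₂ h₁ h₂ => rw [map_add, add_smul, h₁, h₂, eval_add, map_add, add_smul]
    | monomial n c =>
      rw [aeval_monomial, eval_monomial, map_mul, mul_smul, mul_smul]
      congr 1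
      induction n with
      | zero => simp
      | succ n ih =>
        rw [pow_succ, mul_smul, hwt, ← mul_smul, ← Algebra.commutes, mul_smul, ih, ← mul_smul,
          ← map_mul, pow_succ']
  by_contra hne
  have h2 := h1 p
  rw [Module.mem_annihilator.1 hp m] at h2
  apply hm
  have h3 := congrArg (algebraMap ℂ (U r) (p.eval (μ h))⁻¹ • ·) h2
  simp only [smul_zero] at h3
  rw [← mul_smul, ← map_mul, inv_mul_cancel₀ hne, map_one, one_smul] at h3
  exact h3.symm

-- The coroot `h₁` has only the eigenvalues `0, ±1, ±2` on 3 × 3 matrices, while `3ω₁` takes the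
-- value `3` on it.
open Polynomial in
theorem not_isWeight_three_fundWeight :
    ¬ IsWeight (IrrL 2 (fundWeight 2 0 + fundWeight 2 1)) (3 • fundWeight 2 0) := by
  rw [fundWeight_add, fundWeight_zero]
  intro hμ
  let p : ℂ[X] := (X - C 2) * ((X - C 1) * ((X - C 0) * ((X - C (-1)) * (X - C (-2)))))
  have hp : aeval (toU 2 (corootH 2 0)) p ∈
      Module.annihilator (U 2) (IrrL 2 (eps 2 0 - eps 2 2)) := by
    apply mem_annihilator_irrL_highestRoot
    have hT : ∀ (z : ℂ) (m : Matrix (Fin 3) (Fin 3) ℂ) (i j : Fin 3),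
        aeval (matrixAct 2 (toU 2 (corootH 2 0))) (X - C z) m i j =
          (eps 2 i (corootH 2 0) - eps 2 j (corootH 2 0) - z) * m i j := by
      intro z m i j
      rw [map_sub, aeval_X, aeval_C, LinearMap.sub_apply, Module.algebraMap_end_apply,
        matrixAct_toU, cartan_eq_diagonal]
      rw [Matrix.sub_apply, Matrix.sub_apply, Matrix.diagonal_mul, Matrix.mul_diagonal,
        Matrix.smul_apply, smul_eq_mul]
      ring
    rw [← aeval_algHom_apply]
    refine LinearMap.ext fun m => ?_
    ext i j
    simp only [p, map_mul, Module.End.mul_apply, hT, LinearMap.zero_apply, eps_corootH]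
    fin_cases i <;> fin_cases j <;> norm_num
  have h := hμ.eval_eq_zero _ hp
  simp [p, eps_corootH] at h
  norm_num at h

end SlQuotients

theorem mainTheorem8 :
    -- for `𝔰𝔩₃` and `w = (1, 1)`: `ω_w = ω₁ + ω₂`, a partition of `d = 3`
    omega 2 ![1, 1] = fundWeight 2 0 + fundWeight 2 1 ∧
    IsPartitionOf (omega 2 ![1, 1]) 3 ∧
    -- `3ω₁` is a partition of `3`, but it is not a weight of `L(ω₁ + ω₂)`
    IsPartitionOf (3 • fundWeight 2 0) 3 ∧
    ¬ IsWeight (IrrL 2 (fundWeight 2 0 + fundWeight 2 1)) (3 • fundWeight 2 0) ∧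
    -- the two ideals are different, and so are the two quotients, even as abstract algebras
    ginzburgIdeal 2 3 ≠ nakajimaIdeal 2 ![1, 1] ∧
    IsEmpty ((U 2 ⧸ ginzburgIdeal 2 3) ≃ₐ[ℂ] (U 2 ⧸ nakajimaIdeal 2 ![1, 1])) := by
  refine ⟨omega_one_one, ⟨![1, 1], rfl, sum_part 1 1⟩, ⟨![3, 0], omega_three_zero.symm, sum_part 3 0⟩,
    not_isWeight_three_fundWeight, fun h => ?_, isEmpty_quotient_algEquiv⟩
  exact isEmpty_quotient_algEquiv.false (Ideal.quotientEquivAlgOfEq ℂ h)
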